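/- For $w$ in the free group $F(a,b)$ let $f_w\in\mathbb Z[x,y,z]$ be its trace polynomial, that is, the unique polynomial with $\operatorname{Tr}(w(A,B))=f_w(\operatorname{Tr}A,\operatorname{Tr}B,\operatorname{Tr}AB)$ for all $A,B\in\operatorname{SL}(2,\mathbb C)$, and let $\deg f_w$ denote its total degree. (1) Let $s\ge 1$, let $\alpha_1,\beta_1,\dots,\alpha_s,\beta_s$ be positive integers, let $w=a^{\alpha_1}b^{\beta_1}\cdots a^{\alpha_s}b^{\beta_s}$ and $n=\sum_{i=1}^s(\alpha_i+\beta_i)$. Then $n$ is the cyclically reduced length of $w$, and \[ \deg f_w=n-s. \] (2) For every $D>0$ there are constants $C_D,C'_D>0$, depending only on $D$, such that the following holds for every $p\in(0,1)$ and every $n\ge 1$. If $w_n=\xi_1\cdots\xi_n$ is a random positive word whose letters $\xi_i\in\{a,b\}$ are independent with $\Pr(\xi_i=a)=p$ and $\Pr(\xi_i=b)=1-p$, then \[ \Pr\Bigl(\bigl|\deg f_{w_n}-(1-p(1-p))\,n\bigr|\le C_D\sqrt{n\log n}\Bigr)\ \ge\ 1-C'_D\,n^{-D}. \] (3) In the degenerate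 cases $p=0$ and $p=1$ of the same model, $\deg f_{w_n}=n$ almost surely, for every $n$. -/

import Mathlib

open MeasureTheory ProbabilityTheory

namespace TracePoly

/-- The free group `F(a, b)`; the generator `a` has index `0` and `b` has index `1`. -/
abbrev F2 : Type := FreeGroup (Fin 2)

/-- The free generator `a`. -/
def a : F2 := FreeGroup.of 0

/-- The free generator `b`. -/
def b : F2 := FreeGroup.of 1

/-- The group `SL(2, ℂ)`. -/
abbrev SL2 : Type := Matrix.SpecialLinearGroup (Fin 2) ℂ

/-- The algebra of complex two-by-two matrices. -/
abbrev M2 : Type := Matrix (Fin 2) (Fin 2) ℂ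

/-- The value `w(A, B)`: the image of `w` under the homomorphism with `a ↦ A` and `b ↦ B`. -/
def wordValue (A B : SL2) : F2 →* SL2 := FreeGroup.lift ![A, B]

/-- The trace of an element of `SL(2, ℂ)`. -/
def tr (A : SL2) : ℂ := Matrix.trace (A : M2)

/-- The value `f (Tr A, Tr B, Tr AB)` of `f ∈ ℤ[x, y, z]`; the variables `x, y, z` have the
indices `0, 1, 2`. -/
noncomputable def traceEval (A B : SL2) : MvPolynomial (Fin 3) ℤ →ₐ[ℤ] ℂ :=
  MvPolynomial.aeval ![tr A, tr B, tr (A * B)]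

/-- `f ∈ ℤ[x, y, z]` satisfies `Tr w(A, B) = f (Tr A, Tr B, Tr AB)` for all `A, B ∈ SL(2, ℂ)`. -/
def IsTracePolynomial (w : F2) (f : MvPolynomial (Fin 3) ℤ) : Prop :=
  ∀ A B : SL2, tr (wordValue A B w) = traceEval A B f

/-! ### Existence and uniqueness of the trace polynomial -/

/-- A matrix function of `A, B` that is a combination of `1, A, B, AB` with coefficients in
`ℤ[Tr A, Tr B, Tr AB]`. -/
def Rep (M : SL2 → SL2 → M2) : Prop :=
  ∃ p q r s : MvPolynomial (Fin 3) ℤ, ∀ A B : SL2,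
    M A B = traceEval A B p • (1 : M2) + traceEval A B q • (A : M2) +
      traceEval A B r • (B : M2) + traceEval A B s • ((A : M2) * (B : M2))

theorem det_eq (A : SL2) : (A : M2) 0 0 * (A : M2) 1 1 - (A : M2) 0 1 * (A : M2) 1 0 = 1 := by
  rw [← Matrix.det_fin_two]
  exact A.2

theorem traceEval_X0 (A B : SL2) :
    traceEval A B (MvPolynomial.X 0) = (A : M2) 0 0 + (A : M2) 1 1 := by
  simp [traceEval, tr, Matrix.trace_fin_two]

theorem traceEval_X1 (A B : SL2) :
    traceEval A B (MvPolynomial.X 1) = (B : M2) 0 0 + (B : M2) 1 1 := by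
  simp [traceEval, tr, Matrix.trace_fin_two]

theorem traceEval_X2 (A B : SL2) :
    traceEval A B (MvPolynomial.X 2) = (A : M2) 0 0 * (B : M2) 0 0 + (A : M2) 0 1 * (B : M2) 1 0 +
      ((A : M2) 1 0 * (B : M2) 0 1 + (A : M2) 1 1 * (B : M2) 1 1) := by
  simp [traceEval, tr, Matrix.trace_fin_two, Matrix.mul_apply, Fin.sum_univ_two]

theorem inv_eq (A : SL2) : ((A⁻¹ : SL2) : M2) = tr A • (1 : M2) - (A : M2) := by
  rw [Matrix.SpecialLinearGroup.coe_inv, Matrix.adjugate_fin_two]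
  ext i j
  fin_cases i <;> fin_cases j <;> simp [tr, Matrix.trace_fin_two]

theorem Rep.mulA {M : SL2 → SL2 → M2} (h : Rep M) : Rep fun A B => M A B * (A : M2) := by
  obtain ⟨p, q, r, s, h⟩ := h
  let x : MvPolynomial (Fin 3) ℤ := MvPolynomial.X 0
  let y : MvPolynomial (Fin 3) ℤ := MvPolynomial.X 1
  let z : MvPolynomial (Fin 3) ℤ := MvPolynomial.X 2
  refine ⟨-q + (z - x * y) * r - y * s, p + x * q + y * r + z * s, x * r + s, -r,
    fun A B => ?_⟩
  have hA := det_eq A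
  simp only [h, map_add, map_sub, map_mul, map_neg, x, y, z, traceEval_X0, traceEval_X1,
    traceEval_X2]
  generalize traceEval A B p = p
  generalize traceEval A B q = q
  generalize traceEval A B r = r
  generalize traceEval A B s = s
  ext i j
  fin_cases i <;> fin_cases j <;> simp [Matrix.mul_apply, Fin.sum_univ_two]
  · linear_combination (-q + s * ((B : M2) 0 0 - ((B : M2) 0 0 + (B : M2) 1 1))) * hA
  · linear_combination (s * (B : M2) 0 1) * hA
  · linear_combination (s * (B : M2) 1 0) * hA
  · linear_combination (-q + s * ((B : M2) 1 1 - ((B : M2) 0 0 + (B : M2) 1 1))) * hA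

theorem Rep.mulB {M : SL2 → SL2 → M2} (h : Rep M) : Rep fun A B => M A B * (B : M2) := by
  obtain ⟨p, q, r, s, h⟩ := h
  let y : MvPolynomial (Fin 3) ℤ := MvPolynomial.X 1
  refine ⟨-r, -s, p + y * r, q + y * s, fun A B => ?_⟩
  have hB := det_eq B
  simp only [h, map_add, map_mul, map_neg, y, traceEval_X1]
  generalize traceEval A B p = p
  generalize traceEval A B q = q
  generalize traceEval A B r = r
  generalize traceEval A B s = s
  ext i j
  fin_cases i <;> fin_cases j <;> simp [Matrix.mul_apply, Fin.sum_univ_two]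
  · linear_combination (-r - s * (A : M2) 0 0) * hB
  · linear_combination (-s * (A : M2) 0 1) * hB
  · linear_combination (-s * (A : M2) 1 0) * hB
  · linear_combination (-r - s * (A : M2) 1 1) * hB

theorem Rep.sub {M N : SL2 → SL2 → M2} (h : Rep M) (k : Rep N) :
    Rep fun A B => M A B - N A B := by
  obtain ⟨p, q, r, s, h⟩ := h
  obtain ⟨p', q', r', s', k⟩ := k
  refine ⟨p - p', q - q', r - r', s - s', fun A B => ?_⟩
  simp only [h, k, map_sub, sub_smul]
  abel

theorem Rep.smul {M : SL2 → SL2 → M2} (h : Rep M) (f : MvPolynomial (Fin 3) ℤ) :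
    Rep fun A B => traceEval A B f • M A B := by
  obtain ⟨p, q, r, s, h⟩ := h
  refine ⟨f * p, f * q, f * r, f * s, fun A B => ?_⟩
  simp only [h, map_mul, smul_add, smul_smul]

theorem Rep.word (w : F2) : Rep fun A B => ((wordValue A B w : SL2) : M2) := by
  rw [← FreeGroup.mk_toWord (x := w)]
  induction w.toWord using List.reverseRecOn with
  | nil =>
    refine ⟨1, 0, 0, 0, fun A B => ?_⟩
    rw [show (FreeGroup.mk [] : F2) = 1 from rfl, map_one]
    simp
  | append_singleton l c ih =>
    have hmul : ∀ A B : SL2, ((wordValue A B (FreeGroup.mk (l ++ [c])) : SL2) : M2) =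
        ((wordValue A B (FreeGroup.mk l) : SL2) : M2) *
          ((wordValue A B (FreeGroup.mk [c]) : SL2) : M2) := by
      intro A B
      rw [← FreeGroup.mul_mk, map_mul, Matrix.SpecialLinearGroup.coe_mul]
    simp only [hmul]
    obtain ⟨i, e⟩ := c
    have hx : ∀ A B, tr A = traceEval A B (MvPolynomial.X 0) := by simp [traceEval]
    have hy : ∀ A B, tr B = traceEval A B (MvPolynomial.X 1) := by simp [traceEval]
    fin_cases i <;> cases e
    · have hv : ∀ A B : SL2, wordValue A B (FreeGroup.mk [((0 : Fin 2), false)]) = A⁻¹ := by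
        simp [wordValue]
      convert (ih.smul (MvPolynomial.X 0)).sub ih.mulA using 3 with A B
      simp only [Fin.zero_eta, hv, inv_eq, hx A B, mul_sub, mul_smul_comm, mul_one]
    · have hv : ∀ A B : SL2, wordValue A B (FreeGroup.mk [((0 : Fin 2), true)]) = A := by
        simp [wordValue]
      simpa only [Fin.zero_eta, hv] using ih.mulA
    · have hv : ∀ A B : SL2, wordValue A B (FreeGroup.mk [((1 : Fin 2), false)]) = B⁻¹ := by
        simp [wordValue]
      convert (ih.smul (MvPolynomial.X 1)).sub ih.mulB using 3 with A B
      simp only [Fin.mk_one, hv, inv_eq, hy A B, mul_sub, mul_smul_comm, mul_one]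
    · have hv : ∀ A B : SL2, wordValue A B (FreeGroup.mk [((1 : Fin 2), true)]) = B := by
        simp [wordValue]
      simpa only [Fin.mk_one, hv] using ih.mulB

theorem exists_isTracePolynomial (w : F2) : ∃ f, IsTracePolynomial w f := by
  obtain ⟨p, q, r, s, h⟩ := Rep.word w
  refine ⟨2 * p + MvPolynomial.X 0 * q + MvPolynomial.X 1 * r + MvPolynomial.X 2 * s,
    fun A B => ?_⟩
  have h2 : traceEval A B 2 = 2 := map_ofNat _ 2
  have hw := h A B
  simp only at hw
  rw [tr, hw]
  simp only [map_add, map_mul, h2, traceEval_X0, traceEval_X1, traceEval_X2]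
  simp [Matrix.trace_fin_two, Matrix.mul_apply, Fin.sum_univ_two]
  ring

/-- Every point of `ℂ³` is `(Tr A, Tr B, Tr AB)` for some `A, B ∈ SL(2, ℂ)`. -/
theorem exists_traces (x y z : ℂ) : ∃ A B : SL2, tr A = x ∧ tr B = y ∧ tr (A * B) = z := by
  obtain ⟨d, hd⟩ := IsAlgClosed.exists_pow_nat_eq (z ^ 2 - 4) (n := 2) (by norm_num)
  let u : ℂ := (z + d) / 2
  let v : ℂ := (z - d) / 2
  have huv : u * v = 1 := by
    simp only [u, v]
    linear_combination (-1 / 4 : ℂ) * hd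
  refine ⟨⟨!![x, -1; 1, 0], by simp [Matrix.det_fin_two]⟩,
    ⟨!![0, u; -v, y], by simp [Matrix.det_fin_two, huv]⟩, ?_, ?_, ?_⟩
  · simp [tr, Matrix.trace_fin_two]
  · simp [tr, Matrix.trace_fin_two]
  · change Matrix.trace ((!![x, -1; 1, 0] : M2) * (!![0, u; -v, y] : M2)) = z
    simp [Matrix.trace_fin_two, u, v]
    ring

theorem existsUnique_isTracePolynomial (w : F2) : ∃! f, IsTracePolynomial w f := by
  obtain ⟨f, hf⟩ := exists_isTracePolynomial w
  refine ⟨f, hf, fun g hg => ?_⟩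
  apply MvPolynomial.map_injective (Int.castRingHom ℂ) Int.cast_injective
  apply MvPolynomial.funext
  intro t
  obtain ⟨A, B, hx, hy, hz⟩ := exists_traces (t 0) (t 1) (t 2)
  have ht : ![tr A, tr B, tr (A * B)] = t := by
    ext i
    fin_cases i <;> simp [hx, hy, hz]
  have h := (hg A B).symm.trans (hf A B)
  simp only [traceEval, ht] at h
  simpa [MvPolynomial.aeval_def, MvPolynomial.eval_map] using h

/-- The trace polynomial `f_w ∈ ℤ[x, y, z]` of `w ∈ F(a, b)`: the unique polynomial with
`Tr w(A, B) = f_w (Tr A, Tr B, Tr AB)` for all `A, B ∈ SL(2, ℂ)`. -/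
noncomputable def tracePolynomial (w : F2) : MvPolynomial (Fin 3) ℤ :=
  (existsUnique_isTracePolynomial w).choose

theorem tracePolynomial_spec (w : F2) : IsTracePolynomial w (tracePolynomial w) :=
  (existsUnique_isTracePolynomial w).choose_spec.1

/-- The total degree of the trace polynomial `f_w`. -/
noncomputable def degTrace (w : F2) : ℕ := (tracePolynomial w).totalDegree

/-! ### Words -/

/-- The cyclically reduced length `‖w‖` of `w ∈ F(a, b)` with respect to the basis `{a, b}`. -/
def cyclicLength (w : F2) : ℕ := (FreeGroup.reduceCyclically w.toWord).length

/-- The word `a ^ α₁ * b ^ β₁ * ⋯ * a ^ αₛ * b ^ βₛ`. -/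
def syllableWord {s : ℕ} (α β : Fin s → ℕ) : F2 :=
  (List.ofFn fun i => a ^ α i * b ^ β i).prod

/-- The positive word `c₁ c₂ ⋯ cₙ`, where the letter `0` stands for `a` and `1` for `b`. -/
def positiveWord {n : ℕ} (c : Fin n → Fin 2) : F2 :=
  (List.ofFn fun i => if c i = 0 then a else b).prod

/-- The letters `ξ₁, …, ξₙ` are independent random variables with `Pr(a) = p` and
`Pr(b) = 1 - p`. -/
structure IsIIDLetters {Ω : Type*} [MeasurableSpace Ω] (μ : Measure Ω) {n : ℕ} (p : ℝ)
    (ξ : Fin n → Ω → Fin 2) : Prop where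
  measurable : ∀ i, Measurable (ξ i)
  indep : iIndepFun ξ μ
  prob_a : ∀ i, μ.real {ω | ξ i ω = 0} = p
  prob_b : ∀ i, μ.real {ω | ξ i ω = 1} = 1 - p

end TracePoly

namespace TracePoly

open Filter Topology

/-! ### The total degree as a growth rate -/

/-! The degree is read off as a growth rate. Along a family of pairs with traces asymptotic to `X t,
Y t, Z t`, the value of `f_w` divided by `t ^ deg f_w` tends to the top homogeneous component at
`(X, Y, Z)`. If `Tr w` grows exactly like `t ^ d` whenever `X, Y, Z` are nonzero, then `d` is the
degree (`degTrace_eq_of_tendsto`).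

In the family used here, `A / t` and `B / t` tend to `!![X, 0; 0, 0]` and `!![0, Z; 0, Y]`. The
limit of `A` times the limit of `B` is nilpotent, so each passage from `a` to `b` costs one power of
`t`. After conjugation by `diag(t, 1)`, a syllable `a ^ α * b ^ β` divided by `t ^ (α + β - 1)` has
an upper triangular limit with diagonal `0, X ^ (α - 1) * Z * Y ^ (β - 1)`. Such limits multiply
without further cancellation (`tendsto_syllables`), and the degree is `n - s`.

A positive word is, up to rotation, a pure power or a product of syllables, so its degree is its
length minus the number of occurrences of `ab`, up to one for the wrap-around. That number is a sum
of indicators of mean `p (1 - p)`; those at positions of equal parity read disjoint letters and are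
independent, so Hoeffding's inequality on each parity class gives the concentration, uniformly in
`p`. -/

theorem tendsto_inv_ofReal_atTop : Tendsto (fun t : ℝ => ((t : ℂ))⁻¹) atTop (𝓝 0) := by
  have h := (Complex.continuous_ofReal.tendsto 0).comp tendsto_inv_atTop_zero
  simpa [Function.comp_def] using h

theorem eventually_ofReal_ne_zero : ∀ᶠ t : ℝ in atTop, (t : ℂ) ≠ 0 := by
  filter_upwards [eventually_gt_atTop 0] with t ht
  exact_mod_cast ht.ne'

theorem tendsto_div_pow_of_lt {g : ℝ → ℂ} {c : ℂ} {m k : ℕ} (hmk : m < k)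
    (h : Tendsto (fun t : ℝ => g t / (t : ℂ) ^ m) atTop (𝓝 c)) :
    Tendsto (fun t : ℝ => g t / (t : ℂ) ^ k) atTop (𝓝 0) := by
  have h1 := h.mul (tendsto_inv_ofReal_atTop.pow (k - m))
  rw [zero_pow (by omega), mul_zero] at h1
  refine h1.congr' ?_
  filter_upwards [eventually_ofReal_ne_zero] with t ht
  obtain ⟨j, rfl⟩ := Nat.exists_eq_add_of_lt hmk
  rw [show m + j + 1 - m = j + 1 by omega, add_assoc, pow_add _ m, inv_pow,
    div_mul_eq_div_div, div_eq_mul_inv (g t / _)]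

theorem growth_exponent_unique {g : ℝ → ℂ} {c d : ℂ} {m k : ℕ} (hc : c ≠ 0) (hd : d ≠ 0)
    (h : Tendsto (fun t : ℝ => g t / (t : ℂ) ^ m) atTop (𝓝 c))
    (h' : Tendsto (fun t : ℝ => g t / (t : ℂ) ^ k) atTop (𝓝 d)) : m = k := by
  rcases lt_trichotomy m k with hl | hl | hl
  · exact absurd (tendsto_nhds_unique h' (tendsto_div_pow_of_lt hl h)) hd
  · exact hl
  · exact absurd (tendsto_nhds_unique h (tendsto_div_pow_of_lt hl h')) hc

open MvPolynomial in
theorem tendsto_eval_div_pow_totalDegree {σ : Type*} [Fintype σ] (F : MvPolynomial σ ℂ)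
    {u : ℝ → σ → ℂ} {v : σ → ℂ}
    (hu : ∀ i, Tendsto (fun t : ℝ => u t i / (t : ℂ)) atTop (𝓝 (v i))) :
    Tendsto (fun t : ℝ => eval (u t) F / (t : ℂ) ^ F.totalDegree) atTop
      (𝓝 (eval v (homogeneousComponent F.totalDegree F))) := by
  rw [homogeneousComponent_apply, map_sum, Finset.sum_filter]
  simp only [fun t => eval_eq' (u t) F, Finset.sum_div]
  refine tendsto_finsetSum _ fun d hd => ?_
  have hp : Tendsto (fun t : ℝ => coeff d F * ∏ i, (u t i / (t : ℂ)) ^ d i) atTop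
      (𝓝 (coeff d F * ∏ i, v i ^ d i)) :=
    (tendsto_finsetProd _ fun i _ => (hu i).pow (d i)).const_mul _
  have hp' : Tendsto (fun t : ℝ => (coeff d F * ∏ i, u t i ^ d i) / (t : ℂ) ^ d.degree) atTop
      (𝓝 (coeff d F * ∏ i, v i ^ d i)) := by
    refine hp.congr fun t => ?_
    simp only [div_pow, Finset.prod_div_distrib, Finset.prod_pow_eq_pow_sum,
      Finsupp.degree_eq_sum, mul_div_assoc]
  split_ifs with hdeg
  · rw [hdeg] at hp'
    simpa [eval_monomial, Finsupp.prod_fintype] using hp'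
  · refine tendsto_div_pow_of_lt (lt_of_le_of_ne ?_ hdeg) hp'
    rw [Finsupp.degree_eq_sum, ← Finsupp.sum_fintype d (fun _ e => e) (fun _ => rfl)]
    exact le_totalDegree hd

open MvPolynomial in
theorem exists_eval_homogeneousComponent_totalDegree_ne_zero {σ : Type*} [Fintype σ]
    {F : MvPolynomial σ ℂ} (hF : F ≠ 0) :
    ∃ v : σ → ℂ, (∀ i, v i ≠ 0) ∧ eval v (homogeneousComponent F.totalDegree F) ≠ 0 := by
  have hH : homogeneousComponent F.totalDegree F ≠ 0 := by
    obtain ⟨d, hd, hdeg⟩ := Finset.exists_mem_eq_sup F.support (support_nonempty.2 hF)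
      (fun s => s.sum fun _ e => e)
    intro h
    have h1 := congrArg (coeff d) h
    rw [coeff_homogeneousComponent, if_pos, coeff_zero] at h1
    · exact (mem_support_iff.1 hd) h1
    · rw [Finsupp.degree_eq_sum, ← Finsupp.sum_fintype d (fun _ e => e) (fun _ => rfl)]
      exact hdeg.symm
  -- Multiplying by all the variables forces a point of nonvanishing to have nonzero coordinates.
  have hG : homogeneousComponent F.totalDegree F * ∏ i, X i ≠ 0 :=
    mul_ne_zero hH (Finset.prod_ne_zero_iff.2 fun i _ => X_ne_zero i)
  by_contra! hcon
  refine hG (MvPolynomial.funext fun v => ?_)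
  rw [map_zero, map_mul, map_prod]
  by_cases hv : ∀ i, v i ≠ 0
  · rw [hcon v hv, zero_mul]
  · push Not at hv
    obtain ⟨i, hi⟩ := hv
    rw [Finset.prod_eq_zero (Finset.mem_univ i) (by simpa using hi), mul_zero]

/-! ### A one-parameter family of pairs of matrices with linearly growing traces -/

/-- The matrix `A` of the family, of trace `X t`. -/
def famA (X : ℂ) (t : ℝ) : SL2 := ⟨!![X * t, -1; 1, 0], by simp [Matrix.det_fin_two]⟩

/-- The matrix `B` of the family, of trace `Y t` when `Z t ≠ 0`. -/
noncomputable def famB (Y Z : ℂ) (t : ℝ) : SL2 :=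
  -- The default value `1` only keeps the determinant equal to one; it is never met for `Z ≠ 0` and
  -- large `t`.
  ⟨if Z * t ≠ 0 then !![0, Z * t; -(Z * t)⁻¹, Y * t] else 1, by
    split_ifs with h
    · rw [Matrix.det_fin_two_of, zero_mul, zero_sub, mul_neg, neg_neg, mul_inv_cancel₀ h]
    · exact Matrix.det_one⟩

theorem coe_famA (X : ℂ) (t : ℝ) : (famA X t : M2) = !![X * t, -1; 1, 0] := rfl

theorem coe_famB (Y : ℂ) {Z : ℂ} (hZ : Z ≠ 0) {t : ℝ} (ht : (t : ℂ) ≠ 0) :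
    (famB Y Z t : M2) = !![0, Z * t; -(Z * t)⁻¹, Y * t] := by
  exact if_pos (mul_ne_zero hZ ht)

theorem tendsto_trace_family {X Y Z : ℂ} (hZ : Z ≠ 0) (i : Fin 3) :
    Tendsto (fun t : ℝ =>
        (![tr (famA X t), tr (famB Y Z t), tr (famA X t * famB Y Z t)] i) / (t : ℂ))
      atTop (𝓝 (![X, Y, Z] i)) := by
  fin_cases i
  · refine tendsto_const_nhds.congr' ?_
    filter_upwards [eventually_ofReal_ne_zero] with t ht
    simp [tr, coe_famA, Matrix.trace_fin_two, ht]
  · refine tendsto_const_nhds.congr' ?_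
    filter_upwards [eventually_ofReal_ne_zero] with t ht
    simp [tr, coe_famB Y hZ ht, Matrix.trace_fin_two, ht]
  · have h : Tendsto (fun t : ℝ => Z + Z⁻¹ * ((t : ℂ)⁻¹) ^ 2) atTop (𝓝 (Z + Z⁻¹ * 0 ^ 2)) :=
      ((tendsto_inv_ofReal_atTop.pow 2).const_mul _).const_add _
    rw [zero_pow two_ne_zero, mul_zero, add_zero] at h
    refine h.congr' ?_
    filter_upwards [eventually_ofReal_ne_zero] with t ht
    simp [tr, coe_famA, coe_famB Y hZ ht, Matrix.trace_fin_two]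
    field_simp
    ring

/-- If the trace of `w` along every family grows exactly like `t ^ d`, then `deg f_w = d`. -/
theorem degTrace_eq_of_tendsto {w : F2} {d : ℕ}
    (h : ∀ X Y Z : ℂ, X ≠ 0 → Y ≠ 0 → Z ≠ 0 → ∃ c : ℂ, c ≠ 0 ∧
      Tendsto (fun t : ℝ => tr (wordValue (famA X t) (famB Y Z t) w) / (t : ℂ) ^ d) atTop (𝓝 c)) :
    degTrace w = d := by
  set F : MvPolynomial (Fin 3) ℂ := MvPolynomial.map (Int.castRingHom ℂ) (tracePolynomial w)
    with hFdef
  have heval : ∀ A B : SL2, tr (wordValue A B w) =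
      MvPolynomial.eval ![tr A, tr B, tr (A * B)] F := by
    intro A B
    rw [tracePolynomial_spec w A B, traceEval, hFdef, MvPolynomial.eval_map,
      MvPolynomial.aeval_def]
    rfl
  simp only [heval] at h
  have hdeg : degTrace w = F.totalDegree := by
    rw [degTrace, MvPolynomial.totalDegree, MvPolynomial.totalDegree, hFdef,
      MvPolynomial.support_map_of_injective _ (Int.castRingHom ℂ).injective_int]
  have hF : F ≠ 0 := by
    intro hF
    obtain ⟨c, hc, hlim⟩ := h 1 1 1 one_ne_zero one_ne_zero one_ne_zero
    simp only [hF, map_zero, zero_div] at hlim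
    exact hc (tendsto_nhds_unique hlim tendsto_const_nhds)
  -- At this point both exponents, `F.totalDegree` and `d`, have nonzero limits, so they agree.
  obtain ⟨v, hv, hne⟩ := exists_eval_homogeneousComponent_totalDegree_ne_zero hF
  obtain ⟨c, hc, hlim⟩ := h (v 0) (v 1) (v 2) (hv 0) (hv 1) (hv 2)
  have hv3 : ![v 0, v 1, v 2] = v := by
    ext i
    fin_cases i <;> rfl
  rw [hdeg]
  refine growth_exponent_unique hne hc ?_ hlim
  refine tendsto_eval_div_pow_totalDegree F fun i => ?_
  have := tendsto_trace_family (X := v 0) (Y := v 1) (hv 2) i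
  rwa [hv3] at this
/-! ### Growth of the values of positive words along the family -/

/-- The word `a ^ (k + 1) * b ^ (m + 1)`, where `e = (k, m)`. -/
def syllable (e : ℕ × ℕ) : F2 := a ^ (e.1 + 1) * b ^ (e.2 + 1)

/-- The product of the syllables of a list. -/
def syllables (L : List (ℕ × ℕ)) : F2 := (L.map syllable).prod

theorem wordValue_a (A B : SL2) : wordValue A B a = A := by simp [wordValue, a]

theorem wordValue_b (A B : SL2) : wordValue A B b = B := by simp [wordValue, b]

theorem tendsto_matrix_two {f : ℝ → M2} {M : M2} {l : Filter ℝ}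
    (h00 : Tendsto (fun t => f t 0 0) l (𝓝 (M 0 0)))
    (h01 : Tendsto (fun t => f t 0 1) l (𝓝 (M 0 1)))
    (h10 : Tendsto (fun t => f t 1 0) l (𝓝 (M 1 0)))
    (h11 : Tendsto (fun t => f t 1 1) l (𝓝 (M 1 1))) : Tendsto f l (𝓝 M) := by
  refine tendsto_pi_nhds.2 fun i => tendsto_pi_nhds.2 fun j => ?_
  fin_cases i <;> fin_cases j
  exacts [h00, h01, h10, h11]

theorem tendsto_trace {f : ℝ → M2} {M : M2} {l : Filter ℝ} (h : Tendsto f l (𝓝 M)) :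
    Tendsto (fun t => (f t).trace) l (𝓝 M.trace) :=
  ((Continuous.matrix_trace continuous_id).tendsto M).comp h

theorem tendsto_const_mul_inv_ofReal (c : ℂ) :
    Tendsto (fun t : ℝ => c * (t : ℂ)⁻¹) atTop (𝓝 0) := by
  simpa using tendsto_inv_ofReal_atTop.const_mul c

theorem tendsto_smul_famA (X : ℂ) :
    Tendsto (fun t : ℝ => (t : ℂ)⁻¹ • (famA X t : M2)) atTop (𝓝 !![X, 0; 0, 0]) := by
  refine tendsto_matrix_two ?_ ?_ ?_ ?_
  · refine tendsto_const_nhds.congr' ?_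
    filter_upwards [eventually_ofReal_ne_zero] with t ht
    simp [coe_famA]
    field_simp
  · simpa [coe_famA] using tendsto_const_mul_inv_ofReal (-1)
  · simpa [coe_famA] using tendsto_inv_ofReal_atTop
  · simp [coe_famA]

theorem tendsto_smul_famB (Y : ℂ) {Z : ℂ} (hZ : Z ≠ 0) :
    Tendsto (fun t : ℝ => (t : ℂ)⁻¹ • (famB Y Z t : M2)) atTop (𝓝 !![0, Z; 0, Y]) := by
  have hB : ∀ᶠ t : ℝ in atTop, !![0, Z; -(Z⁻¹ * ((t : ℂ)⁻¹) ^ 2), Y] =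
      (t : ℂ)⁻¹ • (famB Y Z t : M2) := by
    filter_upwards [eventually_ofReal_ne_zero] with t ht
    rw [coe_famB Y hZ ht]
    ext i j
    fin_cases i <;> fin_cases j <;> simp <;> field_simp
  refine Tendsto.congr' hB (tendsto_matrix_two ?_ ?_ ?_ ?_) <;>
    simp only [Matrix.of_apply, Matrix.cons_val', Matrix.cons_val_zero, Matrix.cons_val_one,
      Matrix.cons_val_fin_one]
  · exact tendsto_const_nhds
  · exact tendsto_const_nhds
  · simpa using ((tendsto_inv_ofReal_atTop.pow 2).const_mul Z⁻¹).neg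
  · exact tendsto_const_nhds

/-- The diagonal matrix with entries `t` and `1`. -/
def scale (t : ℂ) : M2 := !![t, 0; 0, 1]

/-- The scaling replaces the factor `1 / t` and preserves the lower-left entry `1`, which `A / t`
loses in the limit. This is the power of `t` that a syllable gives up. -/
theorem tendsto_scale_mul_famA (X : ℂ) :
    Tendsto (fun t : ℝ => scale (t : ℂ)⁻¹ * (famA X t : M2)) atTop (𝓝 !![X, 0; 1, 0]) := by
  have hA : ∀ᶠ t : ℝ in atTop, !![X, -1 * (t : ℂ)⁻¹; 1, 0] =
      scale (t : ℂ)⁻¹ * (famA X t : M2) := by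
    filter_upwards [eventually_ofReal_ne_zero] with t ht
    rw [coe_famA, scale]
    ext i j
    fin_cases i <;> fin_cases j <;> simp [Matrix.mul_apply, Fin.sum_univ_two]
    field_simp
  refine Tendsto.congr' hA (tendsto_matrix_two ?_ ?_ ?_ ?_) <;>
    simp only [Matrix.of_apply, Matrix.cons_val', Matrix.cons_val_zero, Matrix.cons_val_one,
      Matrix.cons_val_fin_one]
  · exact tendsto_const_nhds
  · exact tendsto_const_mul_inv_ofReal (-1)
  · exact tendsto_const_nhds
  · exact tendsto_const_nhds

theorem tendsto_smul_famB_mul_scale (Y : ℂ) {Z : ℂ} (hZ : Z ≠ 0) :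
    Tendsto (fun t : ℝ => (t : ℂ)⁻¹ • (famB Y Z t : M2) * scale t) atTop (𝓝 !![0, Z; 0, Y]) := by
  have hB : ∀ᶠ t : ℝ in atTop, !![0, Z; -Z⁻¹ * (t : ℂ)⁻¹, Y] =
      (t : ℂ)⁻¹ • (famB Y Z t : M2) * scale t := by
    filter_upwards [eventually_ofReal_ne_zero] with t ht
    rw [coe_famB Y hZ ht, scale]
    ext i j
    fin_cases i <;> fin_cases j <;> simp [Matrix.mul_apply, Fin.sum_univ_two] <;> field_simp
  refine Tendsto.congr' hB (tendsto_matrix_two ?_ ?_ ?_ ?_) <;>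
    simp only [Matrix.of_apply, Matrix.cons_val', Matrix.cons_val_zero, Matrix.cons_val_one,
      Matrix.cons_val_fin_one]
  · exact tendsto_const_nhds
  · exact tendsto_const_nhds
  · exact tendsto_const_mul_inv_ofReal _
  · exact tendsto_const_nhds

/-- The case `c = 1` serves the scaled first letter of a syllable, the case `c = 0` plain powers of
the limit of `A / t`. -/
theorem pow_succ_of_col_one_zero (X c : ℂ) (k : ℕ) :
    (!![X, 0; c, 0] * !![X, 0; 0, 0] ^ k : M2) = !![X ^ (k + 1), 0; c * X ^ k, 0] := by
  induction k with
  | zero => simp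
  | succ k ih =>
    rw [pow_succ, ← mul_assoc, ih, Matrix.mul_fin_two]
    simp [pow_succ, mul_assoc]

theorem pow_succ_of_col_zero_zero (Y Z : ℂ) (k : ℕ) :
    (!![0, Z; 0, Y] ^ (k + 1) : M2) = !![0, Z * Y ^ k; 0, Y ^ (k + 1)] := by
  induction k with
  | zero => simp
  | succ k ih =>
    rw [pow_succ, ih, Matrix.mul_fin_two]
    simp [pow_succ, mul_assoc]

/-- The first `A` absorbs the left scaling and the last `B` the right one. Every letter but that
first `A` takes a factor `1 / t`, whence the exponent `e.1 + e.2 + 1`. -/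
theorem tendsto_syllable {X Y Z : ℂ} (hZ : Z ≠ 0) (e : ℕ × ℕ) :
    Tendsto (fun t : ℝ => ((t : ℂ) ^ (e.1 + e.2 + 1))⁻¹ • (scale (t : ℂ)⁻¹ *
        (wordValue (famA X t) (famB Y Z t) (syllable e) : SL2) * scale t)) atTop
      (𝓝 !![0, X ^ (e.1 + 1) * (Z * Y ^ e.2); 0, X ^ e.1 * (Z * Y ^ e.2)]) := by
  have h := ((tendsto_scale_mul_famA X).mul ((tendsto_smul_famA X).pow e.1)).mul
    (((tendsto_smul_famB Y hZ).pow e.2).mul (tendsto_smul_famB_mul_scale Y hZ))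
  rw [pow_succ_of_col_one_zero, ← pow_succ, pow_succ_of_col_zero_zero, Matrix.mul_fin_two] at h
  simp only [mul_zero, zero_mul, add_zero, one_mul] at h
  refine h.congr fun t => ?_
  simp only [syllable, map_mul, map_pow, wordValue_a, wordValue_b,
    Matrix.SpecialLinearGroup.coe_mul, Matrix.SpecialLinearGroup.coe_pow, smul_pow, smul_mul_assoc,
    mul_smul_comm, smul_smul, inv_pow, pow_succ' (famA X t : M2), pow_succ (famB Y Z t : M2),
    mul_assoc]
  congr 1
  simp only [pow_add, pow_one, mul_inv]
  ring

theorem scale_mul_scale_inv {t : ℂ} (ht : t ≠ 0) : scale t * scale t⁻¹ = 1 := by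
  rw [scale, scale, Matrix.mul_fin_two, Matrix.one_fin_two]
  simp [ht]

/-- The scalings between adjacent syllables cancel, so the limits multiply. The conditions on `M`
pass through products and make its trace `M 1 1 ≠ 0` once `L` is nonempty. -/
theorem tendsto_syllables {X Y Z : ℂ} (hX : X ≠ 0) (hY : Y ≠ 0) (hZ : Z ≠ 0) (L : List (ℕ × ℕ)) :
    ∃ M : M2, M 1 0 = 0 ∧ M 1 1 ≠ 0 ∧ (L ≠ [] → M 0 0 = 0) ∧
      Tendsto (fun t : ℝ => ((t : ℂ) ^ (L.map fun e => e.1 + e.2 + 1).sum)⁻¹ • (scale (t : ℂ)⁻¹ *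
        (wordValue (famA X t) (famB Y Z t) (syllables L) : SL2) * scale t)) atTop (𝓝 M) := by
  induction L with
  | nil =>
    refine ⟨1, by simp, by simp, by simp, tendsto_const_nhds.congr' ?_⟩
    filter_upwards [eventually_ofReal_ne_zero] with t ht
    have h := scale_mul_scale_inv (inv_ne_zero ht)
    rw [inv_inv] at h
    simp [syllables, h]
  | cons e L ih =>
    obtain ⟨M, h10, h11, -, hM⟩ := ih
    refine ⟨_, ?_, ?_, fun _ => ?_, ((tendsto_syllable (X := X) (Y := Y) hZ e).mul hM).congr' ?_⟩
    · simp [Matrix.mul_apply, Fin.sum_univ_two, h10]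
    · simp [Matrix.mul_apply, Fin.sum_univ_two, h11, hX, hY, hZ]
    · simp [Matrix.mul_apply, Fin.sum_univ_two, h10]
    · filter_upwards [eventually_ofReal_ne_zero] with t ht
      have h := scale_mul_scale_inv ht
      simp only [syllables, List.map_cons, List.prod_cons, List.sum_cons, map_mul,
        Matrix.SpecialLinearGroup.coe_mul, smul_mul_assoc, mul_smul_comm, smul_smul]
      congr 1
      · simp only [pow_add, pow_one, mul_inv]
        ring
      · simp only [mul_assoc]
        rw [← mul_assoc (scale _) (scale _), h, one_mul]

/-! ### The degree of a positive word -/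

theorem degTrace_syllables {L : List (ℕ × ℕ)} (hL : L ≠ []) :
    degTrace (syllables L) = (L.map fun e => e.1 + e.2 + 1).sum := by
  refine degTrace_eq_of_tendsto fun X Y Z hX hY hZ => ?_
  obtain ⟨M, -, h11, h00, hM⟩ := tendsto_syllables hX hY hZ L
  refine ⟨M.trace, by simpa [Matrix.trace_fin_two, h00 hL] using h11,
    (tendsto_trace hM).congr' ?_⟩
  filter_upwards [eventually_ofReal_ne_zero] with t ht
  rw [Matrix.trace_smul, mul_assoc, Matrix.trace_mul_comm, mul_assoc, scale_mul_scale_inv ht,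
    mul_one, smul_eq_mul, mul_comm, ← div_eq_mul_inv, tr]

theorem degTrace_a_pow (n : ℕ) : degTrace (a ^ n) = n := by
  refine degTrace_eq_of_tendsto fun X Y Z hX hY hZ => ?_
  refine ⟨(!![X, 0; 0, 0] ^ n : M2).trace, ?_,
    (tendsto_trace ((tendsto_smul_famA X).pow n)).congr fun t => ?_⟩
  · cases n with
    | zero => simp
    | succ n =>
      have h := pow_succ_of_col_one_zero X 0 n
      rw [← pow_succ'] at h
      simp [h, Matrix.trace_fin_two, hX]
  · rw [smul_pow, Matrix.trace_smul, tr, map_pow, wordValue_a, Matrix.SpecialLinearGroup.coe_pow,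
      smul_eq_mul, inv_pow, mul_comm, div_eq_mul_inv]

theorem degTrace_b_pow (n : ℕ) : degTrace (b ^ n) = n := by
  refine degTrace_eq_of_tendsto fun X Y Z hX hY hZ => ?_
  refine ⟨(!![0, Z; 0, Y] ^ n : M2).trace, ?_,
    (tendsto_trace ((tendsto_smul_famB Y hZ).pow n)).congr fun t => ?_⟩
  · cases n with
    | zero => simp
    | succ n => simp [pow_succ_of_col_zero_zero, Matrix.trace_fin_two, hY]
  · rw [smul_pow, Matrix.trace_smul, tr, map_pow, wordValue_b, Matrix.SpecialLinearGroup.coe_pow,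
      smul_eq_mul, inv_pow, mul_comm, div_eq_mul_inv]

/-- Cyclic invariance of the trace; it allows positive words to be rotated into syllable form. -/
theorem degTrace_mul_comm (g h : F2) : degTrace (g * h) = degTrace (h * g) := by
  have key : IsTracePolynomial (g * h) (tracePolynomial (h * g)) := by
    intro A B
    rw [← tracePolynomial_spec (h * g) A B, map_mul, map_mul, tr, tr,
      Matrix.SpecialLinearGroup.coe_mul, Matrix.SpecialLinearGroup.coe_mul, Matrix.trace_mul_comm]
  rw [degTrace, degTrace,
    (existsUnique_isTracePolynomial (g * h)).unique (tracePolynomial_spec _) key]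
/-! ### Words in syllable form -/

theorem syllables_nil : syllables [] = 1 := rfl

theorem syllables_cons (e : ℕ × ℕ) (L : List (ℕ × ℕ)) :
    syllables (e :: L) = a ^ (e.1 + 1) * b ^ (e.2 + 1) * syllables L := by
  simp [syllables, syllable]

theorem syllables_append (L L' : List (ℕ × ℕ)) :
    syllables (L ++ L') = syllables L * syllables L' := by
  simp [syllables]

theorem syllableWord_eq_syllables {s : ℕ} {α β : Fin s → ℕ} (hα : ∀ i, 0 < α i)
    (hβ : ∀ i, 0 < β i) :
    syllableWord α β = syllables (List.ofFn fun i => (α i - 1, β i - 1)) := by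
  rw [syllableWord, syllables, List.map_ofFn]
  congr 2
  ext1 i
  simp only [Function.comp_apply, syllable]
  rw [Nat.sub_add_cancel (hα i), Nat.sub_add_cancel (hβ i)]

theorem cyclicLength_mk_positive (l : List (Fin 2)) :
    cyclicLength (FreeGroup.mk (l.map fun i => (i, true))) = l.length := by
  -- With all exponents positive nothing cancels, neither inside the word nor between its two ends.
  have hred : FreeGroup.IsReduced (l.map fun i => (i, true)) := by
    rw [FreeGroup.IsReduced, List.isChain_map]
    exact List.Pairwise.isChain (List.pairwise_of_forall fun _ _ _ => rfl)
  rw [cyclicLength, FreeGroup.toWord_mk, hred.reduce_eq]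
  induction l using List.bidirectionalRec with
  | nil => simp
  | singleton i => simp
  | cons_append i l j _ =>
    rw [List.map_cons, List.map_append, List.map_singleton,
      FreeGroup.reduceCyclically.cons_append, if_neg (by simp)]
    simp

theorem a_pow_eq_mk (k : ℕ) :
    a ^ k = FreeGroup.mk ((List.replicate k (0 : Fin 2)).map fun i => (i, true)) := by
  rw [a, FreeGroup.of, FreeGroup.pow_mk]
  simp

theorem b_pow_eq_mk (k : ℕ) :
    b ^ k = FreeGroup.mk ((List.replicate k (1 : Fin 2)).map fun i => (i, true)) := by
  rw [b, FreeGroup.of, FreeGroup.pow_mk]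
  simp

theorem cyclicLength_syllables (L : List (ℕ × ℕ)) :
    cyclicLength (syllables L) = (L.map fun e => e.1 + 1 + (e.2 + 1)).sum := by
  suffices h : ∃ l : List (Fin 2), syllables L = FreeGroup.mk (l.map fun i => (i, true)) ∧
      l.length = (L.map fun e => e.1 + 1 + (e.2 + 1)).sum by
    obtain ⟨l, hl, hlen⟩ := h
    rw [hl, cyclicLength_mk_positive, hlen]
  induction L with
  | nil => exact ⟨[], rfl, rfl⟩
  | cons e L ih =>
    obtain ⟨l, hl, hlen⟩ := ih
    refine ⟨List.replicate (e.1 + 1) 0 ++ List.replicate (e.2 + 1) 1 ++ l, ?_, ?_⟩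
    · rw [syllables_cons, hl, a_pow_eq_mk, b_pow_eq_mk, FreeGroup.mul_mk, FreeGroup.mul_mk]
      simp only [List.map_append]
    · simp [hlen]
      omega

theorem cyclicLength_and_degTrace_syllableWord {s : ℕ} {α β : Fin s → ℕ} (hs : 1 ≤ s)
    (hα : ∀ i, 0 < α i) (hβ : ∀ i, 0 < β i) :
    cyclicLength (syllableWord α β) = ∑ i, (α i + β i) ∧
      degTrace (syllableWord α β) + s = ∑ i, (α i + β i) := by
  rw [syllableWord_eq_syllables hα hβ]
  constructor
  · rw [cyclicLength_syllables, List.map_ofFn, List.sum_ofFn]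
    refine Finset.sum_congr rfl fun i _ => ?_
    simp only [Function.comp_apply]
    rw [Nat.sub_add_cancel (hα i), Nat.sub_add_cancel (hβ i)]
  · rw [degTrace_syllables (by simp; omega), List.map_ofFn, List.sum_ofFn]
    calc _ = ∑ i : Fin s, ((α i - 1 + (β i - 1) + 1) + 1) := by
          simp [Finset.sum_add_distrib, Function.comp_apply]
      _ = _ := Finset.sum_congr rfl fun i _ => by have := hα i; have := hβ i; omega

/-! ### The number of occurrences of `ab` in a positive word -/

/-- The number of occurrences of `ab` in the word `c`. -/
def abCount {n : ℕ} (c : Fin (n + 1) → Fin 2) : ℕ :=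
  ∑ i : Fin n, if c i.castSucc = 0 ∧ c i.succ = 1 then 1 else 0

theorem abCount_succ {n : ℕ} (c : Fin (n + 2) → Fin 2) :
    abCount c = (if c 0 = 0 ∧ c 1 = 1 then 1 else 0) + abCount (Fin.tail c) := by
  rw [abCount, abCount, Fin.sum_univ_succ]
  simp only [Fin.tail, Fin.succ_castSucc, Fin.castSucc_zero, Fin.succ_zero_eq_one]
  rfl

theorem positiveWord_succ {n : ℕ} (c : Fin (n + 1) → Fin 2) :
    positiveWord c = (if c 0 = 0 then a else b) * positiveWord (Fin.tail c) := by
  rw [positiveWord, List.ofFn_succ, List.prod_cons]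
  rfl

/-- Each syllable contains exactly one `ab`, and no other occurrence exists. The last clause
strengthens the induction: it tells whether a prepended `a` creates an occurrence. -/
theorem exists_positiveWord_eq {n : ℕ} (c : Fin (n + 1) → Fin 2) :
    ∃ (k l : ℕ) (L : List (ℕ × ℕ)), positiveWord c = b ^ k * syllables L * a ^ l ∧
      n + 1 = k + (L.map fun e => e.1 + e.2 + 1).sum + L.length + l ∧
      abCount c = L.length ∧ (0 < k ↔ c 0 = 1) := by
  have hcases : ∀ i : Fin 2, i = 0 ∨ i = 1 := by decide
  induction n with
  | zero =>
    rcases hcases (c 0) with h | h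
    · exact ⟨0, 1, [], by simp [positiveWord, h, syllables_nil], by simp, by simp [abCount],
        by simp [h]⟩
    · exact ⟨1, 0, [], by simp [positiveWord, h, syllables_nil], by simp, by simp [abCount],
        by simp [h]⟩
  | succ n ih =>
    obtain ⟨k, l, L, hw, hlen, hcount, hk⟩ := ih (Fin.tail c)
    have hk' : 0 < k ↔ c 1 = 1 := hk
    rw [positiveWord_succ, hw, abCount_succ, hcount]
    rcases hcases (c 0) with h | h
    · rcases k with - | k
      · have h1 : c 1 ≠ 1 := fun h1 => lt_irrefl 0 (hk'.2 h1)
        rcases L with - | ⟨e, L⟩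
        · refine ⟨0, l + 1, [], ?_, ?_, by simp [h1], by simp [h]⟩
          · simp [h, syllables_nil, pow_succ']
          · simp at hlen ⊢
            omega
        · refine ⟨0, l, (e.1 + 1, e.2) :: L, ?_, ?_, by simp [h1], by simp [h]⟩
          · simp [h, syllables_cons, pow_succ' a (e.1 + 1), mul_assoc]
          · simp at hlen ⊢
            omega
      · have h1 : c 1 = 1 := hk'.1 k.succ_pos
        -- The new `a` and the leading block `b ^ (k + 1)` form a new syllable.
        refine ⟨0, l, (0, k) :: L, ?_, ?_, ?_, by simp [h]⟩
        · simp [h, syllables_cons, mul_assoc]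
        · simp at hlen ⊢
          omega
        · simp [h, h1, add_comm]
    · refine ⟨k + 1, l, L, ?_, by omega, by simp [h], by simp [h]⟩
      simp [h, pow_succ', mul_assoc]

theorem degTrace_positiveWord_bounds {n : ℕ} (c : Fin (n + 1) → Fin 2) :
    degTrace (positiveWord c) + abCount c ≤ n + 1 ∧
      n + 1 ≤ degTrace (positiveWord c) + abCount c + 1 := by
  obtain ⟨k, l, L, hw, hlen, hcount, -⟩ := exists_positiveWord_eq c
  rw [hw, hcount]
  rcases k with - | k <;> rcases l with - | l
  · rcases L with - | ⟨e, L⟩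
    · simp at hlen
    · rw [pow_zero, pow_zero, one_mul, mul_one, degTrace_syllables (List.cons_ne_nil _ _)]
      omega
  · rcases L with - | ⟨e, L⟩
    · rw [pow_zero, one_mul, syllables_nil, one_mul, degTrace_a_pow]
      simp at hlen ⊢
      omega
    · have h : a ^ (l + 1) * syllables (e :: L) = syllables ((e.1 + (l + 1), e.2) :: L) := by
        simp only [syllables_cons, ← mul_assoc, ← pow_add]
        ring_nf
      rw [pow_zero, one_mul, degTrace_mul_comm, h, degTrace_syllables (List.cons_ne_nil _ _)]
      simp at hlen ⊢
      omega
  · rcases List.eq_nil_or_concat' L with rfl | ⟨L, e, rfl⟩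
    · rw [pow_zero, mul_one, syllables_nil, mul_one, degTrace_b_pow]
      simp at hlen ⊢
      omega
    · have h : syllables (L ++ [e]) * b ^ (k + 1) = syllables (L ++ [(e.1, e.2 + (k + 1))]) := by
        simp only [syllables_append, syllables_cons, syllables_nil, mul_one, mul_assoc, ← pow_add]
        ring_nf
      rw [pow_zero, mul_one, degTrace_mul_comm, h, degTrace_syllables (by simp)]
      simp at hlen ⊢
      omega
  -- Rotation joins the final `a`-block to the initial `b`-block, one syllable more than there are
  -- occurrences of `ab`. Only this case loses one in the lower bound.
  · have h : syllables L * a ^ (l + 1) * b ^ (k + 1) = syllables (L ++ [(l, k)]) := by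
      simp only [syllables_append, syllables_cons, syllables_nil, mul_one, mul_assoc]
    rw [mul_assoc, degTrace_mul_comm, h, degTrace_syllables (by simp)]
    simp at hlen ⊢
    omega

theorem degTrace_positiveWord_const {n : ℕ} {c : Fin n → Fin 2} (i : Fin 2) (hc : ∀ j, c j = i) :
    degTrace (positiveWord c) = n := by
  have hw : positiveWord c = (if i = 0 then a else b) ^ n := by
    simp [positiveWord, hc, List.ofFn_const]
  rw [hw]
  split_ifs
  · exact degTrace_a_pow n
  · exact degTrace_b_pow n
open scoped NNReal

/-! ### Concentration of the number of occurrences of `ab` -/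

/-- The centred indicator of the occurrence of `ab` at the letters `x, y`. -/
noncomputable def abDev (p : ℝ) (x y : Fin 2) : ℝ :=
  (if x = 0 ∧ y = 1 then 1 else 0) - p * (1 - p)

theorem hasSubgaussianMGF_mono {Ω : Type*} [MeasurableSpace Ω] {μ : Measure Ω} {X : Ω → ℝ}
    {c c' : ℝ≥0} (h : HasSubgaussianMGF X c μ) (hc : c ≤ c') : HasSubgaussianMGF X c' μ where
  integrable_exp_mul := h.integrable_exp_mul
  mgf_le t := (h.mgf_le t).trans (by gcongr)

section

variable {Ω : Type*} [MeasurableSpace Ω] {μ : Measure Ω} [IsProbabilityMeasure μ] {n : ℕ} {p : ℝ}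
  {ξ : Fin (n + 1) → Ω → Fin 2}

theorem hasSubgaussianMGF_abDev (h : IsIIDLetters μ p ξ) (i : Fin n) :
    HasSubgaussianMGF (fun ω => abDev p (ξ i.castSucc ω) (ξ i.succ ω)) (1 / 4) μ := by
  set s : Set Ω := ξ i.castSucc ⁻¹' {0} ∩ ξ i.succ ⁻¹' {1} with hs
  have hms : MeasurableSet s :=
    (h.measurable _ (measurableSet_singleton _)).inter (h.measurable _ (measurableSet_singleton _))
  have hprob : μ.real s = p * (1 - p) := by
    have hind := (h.indep.indepFun (i.castSucc_lt_succ).ne).measure_inter_preimage_eq_mul {0} {1}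
      (measurableSet_singleton _) (measurableSet_singleton _)
    rw [measureReal_def, hs, hind, ENNReal.toReal_mul]
    exact congrArg₂ (· * ·) (h.prob_a i.castSucc) (h.prob_b i.succ)
  -- Hoeffding's lemma on `[0, 1]` gives the parameter `(1 / 2) ^ 2`.
  have hX := hasSubgaussianMGF_of_mem_Icc (μ := μ) (X := s.indicator 1) (a := 0) (b := 1)
    ((measurable_const.indicator hms).aemeasurable) (ae_of_all _ fun ω => by
      by_cases hω : ω ∈ s <;> simp [hω])
  rw [integral_indicator_one hms, hprob] at hX
  convert hX using 1
  · ext ω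
    by_cases hc : ξ i.castSucc ω = 0 ∧ ξ i.succ ω = 1
    · rw [abDev, if_pos hc, Set.indicator_of_mem (show ω ∈ s from hc), Pi.one_apply]
    · rw [abDev, if_neg hc, Set.indicator_of_notMem (show ω ∉ s from hc)]
  · ext
    norm_num

/-- Distinct positions of equal parity differ by at least two, so their letter pairs are disjoint;
the terms are independent and their parameters add. -/
theorem hasSubgaussianMGF_sum_abDev (h : IsIIDLetters μ p ξ) (e : ℕ) (J : Finset (Fin n))
    (hJ : ∀ i ∈ J, (i : ℕ) % 2 = e) :
    HasSubgaussianMGF (fun ω => ∑ i ∈ J, abDev p (ξ i.castSucc ω) (ξ i.succ ω)) (J.card / 4) μ := by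
  classical
  induction J using Finset.induction_on with
  | empty => simp
  | insert i J hi ih =>
    simp only [Finset.sum_insert hi]
    have hJ' : ∀ j ∈ J, (j : ℕ) % 2 = e := fun j hj => hJ j (Finset.mem_insert_of_mem hj)
    let S : Finset (Fin (n + 1)) := {i.castSucc, i.succ}
    let T : Finset (Fin (n + 1)) := J.image Fin.castSucc ∪ J.image Fin.succ
    have hST : Disjoint S T := by
      have hie := hJ i (Finset.mem_insert_self _ _)
      rw [Finset.disjoint_left]
      intro x hx hxT
      have hx' : (x : ℕ) = i ∨ (x : ℕ) = i + 1 := by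
        simpa [S, Fin.ext_iff] using hx
      obtain ⟨j, hj, hxj⟩ : ∃ j ∈ J, (x : ℕ) = j ∨ (x : ℕ) = j + 1 := by
        simp only [T, Finset.mem_union, Finset.mem_image] at hxT
        rcases hxT with ⟨j, hj, rfl⟩ | ⟨j, hj, rfl⟩
        · exact ⟨j, hj, Or.inl rfl⟩
        · exact ⟨j, hj, Or.inr rfl⟩
      have hje := hJ' j hj
      have hij : (i : ℕ) ≠ j := fun hij => hi (Fin.ext hij ▸ hj)
      omega
    let φ : (S → Fin 2) → ℝ := fun v =>
      abDev p (v ⟨i.castSucc, by simp [S]⟩) (v ⟨i.succ, by simp [S]⟩)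
    let ψ : (T → Fin 2) → ℝ := fun v =>
      ∑ j ∈ J.attach, abDev p (v ⟨j.1.castSucc, by simp [T]⟩) (v ⟨j.1.succ, by simp [T]⟩)
    have hind := (h.indep.indepFun_finset S T hST h.measurable).comp
      (Measurable.of_discrete (f := φ)) (Measurable.of_discrete (f := ψ))
    have hψ : (ψ ∘ fun ω (j : T) => ξ j ω) =
        fun ω => ∑ j ∈ J, abDev p (ξ j.castSucc ω) (ξ j.succ ω) := by
      ext ω
      exact Finset.sum_attach J fun j => abDev p (ξ j.castSucc ω) (ξ j.succ ω)
    rw [hψ] at hind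
    convert (hasSubgaussianMGF_abDev h i).add_of_indepFun (ih hJ') hind using 1
    rw [Finset.card_insert_of_notMem hi]
    push_cast
    ring

theorem measure_abs_abCount_sub_ge_le (h : IsIIDLetters μ p ξ) {ε : ℝ} (hε : 0 ≤ ε) :
    μ.real {ω | ε ≤ |(abCount (fun i => ξ i ω) : ℝ) - n * (p * (1 - p))|} ≤
      2 * Real.exp (-ε ^ 2 / (n + 1)) := by
  set X : Ω → ℝ := fun ω => (abCount (fun i => ξ i ω) : ℝ) - n * (p * (1 - p)) with hXdef
  have hX : HasSubgaussianMGF X ((n + 1) / 2) μ := by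
    let J : Finset (Fin n) := Finset.univ.filter fun i => (i : ℕ) % 2 = 0
    let K : Finset (Fin n) := Finset.univ.filter fun i => ¬(i : ℕ) % 2 = 0
    have hadd := (hasSubgaussianMGF_sum_abDev h 0 J (by simp [J])).add
      (hasSubgaussianMGF_sum_abDev h 1 K (by simp [K]))
    have hcard : J.card + K.card = n :=
      (Finset.card_filter_add_card_filter_not (s := (Finset.univ : Finset (Fin n)))
        (fun i => (i : ℕ) % 2 = 0)).trans (Finset.card_fin n)
    have hsum : (fun ω => ∑ i ∈ J, abDev p (ξ i.castSucc ω) (ξ i.succ ω) +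
        ∑ i ∈ K, abDev p (ξ i.castSucc ω) (ξ i.succ ω)) = X := by
      ext ω
      rw [Finset.sum_filter_add_sum_filter_not]
      simp [hXdef, abCount, abDev]
    rw [hsum] at hadd
    refine hasSubgaussianMGF_mono hadd ?_
    -- The two parity sums are dependent, so their parameters combine as `(√(J.card / 4) + √(K.card
    -- / 4)) ^ 2`, which is at most `n / 2`.
    refine add_sq_le.trans ?_
    rw [NNReal.sq_sqrt, NNReal.sq_sqrt, ← add_div, ← Nat.cast_add, hcard, ← NNReal.coe_le_coe]
    push_cast
    linarith
  have hbound : ∀ Y : Ω → ℝ, HasSubgaussianMGF Y ((n + 1) / 2) μ →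
      μ.real {ω | ε ≤ Y ω} ≤ Real.exp (-ε ^ 2 / (n + 1)) := by
    intro Y hY
    refine (hY.measure_ge_le hε).trans_eq ?_
    push_cast
    congr 2
    ring
  calc μ.real {ω | ε ≤ |X ω|} ≤ μ.real ({ω | ε ≤ X ω} ∪ {ω | ε ≤ (-X) ω}) :=
        measureReal_mono fun ω (hω : ε ≤ |X ω|) => show ε ≤ X ω ∨ ε ≤ -X ω from le_abs.1 hω
    _ ≤ μ.real {ω | ε ≤ X ω} + μ.real {ω | ε ≤ (-X) ω} := measureReal_union_le _ _
    _ ≤ _ := by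
        rw [two_mul]
        exact add_le_add (hbound X hX) (hbound _ hX.neg)

/-- The wrap-around shifts by a number in `[-1, 0]`, and having `n` positions for `n + 1` letters
shifts by `p * (1 - p)`, in `[0, 1]`. The signs are opposite, so the total error is at most one. -/
theorem abs_degTrace_sub_le (hp : 0 ≤ p) (hp1 : p ≤ 1) (c : Fin (n + 1) → Fin 2) :
    |(degTrace (positiveWord c) : ℝ) - (1 - p * (1 - p)) * (n + 1)| ≤
      |(abCount c : ℝ) - n * (p * (1 - p))| + 1 := by
  obtain ⟨h1, h2⟩ := degTrace_positiveWord_bounds c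
  have h1' : (degTrace (positiveWord c) : ℝ) + abCount c ≤ n + 1 := by exact_mod_cast h1
  have h2' : (n : ℝ) + 1 ≤ degTrace (positiveWord c) + abCount c + 1 := by exact_mod_cast h2
  have hq0 : 0 ≤ p * (1 - p) := mul_nonneg hp (by linarith)
  have hq1 : p * (1 - p) ≤ 1 := by nlinarith
  have ha := le_abs_self ((abCount c : ℝ) - n * (p * (1 - p)))
  have hb := neg_abs_le ((abCount c : ℝ) - n * (p * (1 - p)))
  rw [abs_le]
  constructor <;> linarith

theorem one_le_sqrt_mul_log {x : ℝ} (hx : 2 ≤ x) : 1 ≤ √(x * Real.log x) := by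
  rw [Real.one_le_sqrt]
  have hlog : Real.log 2 ≤ Real.log x := Real.log_le_log (by norm_num) hx
  have := Real.log_two_gt_d9
  nlinarith

theorem measure_abs_degTrace_sub_le {D : ℝ} (hD : 0 < D) (hp : 0 ≤ p) (hp1 : p ≤ 1)
    (h : IsIIDLetters μ p ξ) :
    1 - 2 * ((n + 1 : ℕ) : ℝ) ^ (-D) ≤
      μ.real {ω | |(degTrace (positiveWord fun i => ξ i ω) : ℝ) -
        (1 - p * (1 - p)) * ((n + 1 : ℕ) : ℝ)| ≤
          (D + 2) * √(((n + 1 : ℕ) : ℝ) * Real.log ((n + 1 : ℕ) : ℝ))} := by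
  -- For words of length one the left side is `1 - 2 < 0`.
  rcases Nat.eq_zero_or_pos n with rfl | hn
  · refine le_trans ?_ measureReal_nonneg
    norm_num
  set N : ℝ := ((n + 1 : ℕ) : ℝ) with hN
  have hN' : N = n + 1 := by simp [hN]
  have hN2 : 2 ≤ N := by
    rw [hN]
    exact_mod_cast Nat.succ_le_succ hn
  have hlog : 0 ≤ Real.log N := Real.log_nonneg (by linarith)
  set r : ℝ := √(N * Real.log N) with hr
  have hr1 : 1 ≤ r := one_le_sqrt_mul_log hN2
  have hrsq : r ^ 2 = N * Real.log N := Real.sq_sqrt (mul_nonneg (by linarith) hlog)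
  -- This deviation gives the tail `2 * N ^ (-(D + 1) ^ 2)`, and `(D + 1) ^ 2 ≥ D`. The additive
  -- error one is absorbed by another `r ≥ 1`, which makes the constant `D + 2`.
  have hbad := measure_abs_abCount_sub_ge_le h (ε := (D + 1) * r) (by positivity)
  have hexp : Real.exp (-((D + 1) * r) ^ 2 / (n + 1)) ≤ N ^ (-D) := by
    rw [Real.rpow_def_of_pos (by linarith), ← hN', mul_pow, hrsq, Real.exp_le_exp,
      show -((D + 1) ^ 2 * (N * Real.log N)) / N = Real.log N * (-(D + 1) ^ 2) by
        field_simp]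
    exact mul_le_mul_of_nonneg_left (by nlinarith) hlog
  set good : Set Ω := {ω | |(degTrace (positiveWord fun i => ξ i ω) : ℝ) -
    (1 - p * (1 - p)) * N| ≤ (D + 2) * r} with hgood
  set bad : Set Ω := {ω | (D + 1) * r ≤ |(abCount (fun i => ξ i ω) : ℝ) - n * (p * (1 - p))|}
    with hbaddef
  have hcover : (Set.univ : Set Ω) ⊆ good ∪ bad := by
    intro ω _
    by_cases hω : ω ∈ bad
    · exact Or.inr hω
    · left
      have hlt : _ < (D + 1) * r := not_le.1 hω
      have := abs_degTrace_sub_le hp hp1 fun i => ξ i ω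
      rw [hgood, Set.mem_ofPred_eq, hN']
      linarith
  have htotal : 1 ≤ μ.real good + μ.real bad := by
    rw [← probReal_univ (μ := μ)]
    exact (measureReal_mono hcover).trans (measureReal_union_le _ _)
  linarith

end

theorem ae_degTrace_eq_of_degenerate {Ω : Type*} [MeasurableSpace Ω] {μ : Measure Ω}
    [IsProbabilityMeasure μ] {n : ℕ} {p : ℝ} {ξ : Fin n → Ω → Fin 2} (hp : p = 0 ∨ p = 1)
    (h : IsIIDLetters μ p ξ) : ∀ᵐ ω ∂μ, degTrace (positiveWord fun i => ξ i ω) = n := by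
  have hnull : ∀ {s : Set Ω}, μ.real s = 0 → ∀ᵐ ω ∂μ, ω ∉ s := fun hs =>
    measure_eq_zero_iff_ae_notMem.1 ((measureReal_eq_zero_iff (measure_ne_top μ _)).1 hs)
  rcases hp with rfl | rfl
  · filter_upwards [ae_all_iff.2 fun i => hnull (h.prob_a i)] with ω hω
    exact degTrace_positiveWord_const 1 fun i => Fin.eq_one_of_ne_zero _ (hω i)
  · filter_upwards [ae_all_iff.2 fun i => hnull ((h.prob_b i).trans (sub_self 1))] with ω hω
    refine degTrace_positiveWord_const 0 fun i => ?_
    have hne : ξ i ω ≠ 1 := hω i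
    omega

end TracePoly

theorem theorem1p2 :
    -- the degree of a positive word in syllable form
    (∀ (s : ℕ) (α β : Fin s → ℕ), 1 ≤ s → (∀ i, 0 < α i) → (∀ i, 0 < β i) →
      ∀ n : ℕ, n = ∑ i, (α i + β i) →
        TracePoly.cyclicLength (TracePoly.syllableWord α β) = n ∧
        (TracePoly.degTrace (TracePoly.syllableWord α β) : ℤ) = (n : ℤ) - (s : ℤ)) ∧
    -- the typical degree of a random positive word
    (∀ D : ℝ, 0 < D → ∃ C C' : ℝ, 0 < C ∧ 0 < C' ∧
      ∀ p : ℝ, 0 < p → p < 1 → ∀ n : ℕ, 1 ≤ n →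
        ∀ (Ω : Type*) [MeasurableSpace Ω] (μ : Measure Ω) [IsProbabilityMeasure μ]
          (ξ : Fin n → Ω → Fin 2), TracePoly.IsIIDLetters μ p ξ →
          1 - C' * (n : ℝ) ^ (-D) ≤
            μ.real {ω | |(TracePoly.degTrace (TracePoly.positiveWord fun i => ξ i ω) : ℝ) - (1 - p * (1 - p)) * n| ≤
              C * Real.sqrt (n * Real.log n)}) ∧
    -- the degenerate cases `p = 0` and `p = 1`
    (∀ p : ℝ, p = 0 ∨ p = 1 → ∀ n : ℕ,
        ∀ (Ω : Type*) [MeasurableSpace Ω] (μ : Measure Ω) [IsProbabilityMeasure μ]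
          (ξ : Fin n → Ω → Fin 2), TracePoly.IsIIDLetters μ p ξ →
          ∀ᵐ ω ∂μ, TracePoly.degTrace (TracePoly.positiveWord fun i => ξ i ω) = n) := by
  refine ⟨fun s α β hs hα hβ n hn => ?_, fun D hD => ?_, fun p hp n Ω _ μ _ ξ h =>
    TracePoly.ae_degTrace_eq_of_degenerate hp h⟩
  · obtain ⟨h1, h2⟩ := TracePoly.cyclicLength_and_degTrace_syllableWord hs hα hβ
    rw [← hn] at h1 h2
    exact ⟨h1, by omega⟩
  · refine ⟨D + 2, 2, by linarith, two_pos, fun p hp hp1 n hn Ω _ μ _ ξ h => ?_⟩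
    obtain ⟨n, rfl⟩ := Nat.exists_eq_add_of_le' hn
    exact TracePoly.measure_abs_degTrace_sub_le hD hp.le hp1.le h
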